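/- Let $\mathcal A$ be a finite alphabet. Let $\mathsf X$ be either a two-sided shift space over $\mathcal A$, that is, a closed subset of $\mathcal A^{\mathbf Z}$ invariant under the shift map $\sigma$, or a one-sided shift space, that is, the set $\mathsf Y^+\subseteq \mathcal A^{\mathbf N}$ of right-rays $x_0x_1x_2\dots$ of the points $x$ of a two-sided shift space $\mathsf Y$. Let $\mathcal B(\mathsf X)$ be the set of finite words, including the empty word, that occur in points of $\mathsf X$. $\mathsf X$ is *irreducible* if for all $u,w\in\mathcal B(\mathsf X)$ there is $v\in\mathcal B(\mathsf X)$ with $uvw\in\mathcal B(\mathsf X)$; it is of *finite type* (an SFT) if it consists of all sequences avoiding some finite set of words; it is *sofic* if it is the image of an SFT over a finite alphabet under a factor map (a continuous surjection commuting with the shift maps), and *strictly sofic* if it is sofic but not an SFT. A two-sided shift space is of *almost finite type* (AFT) if it is the image of an irreducible SFT under a factor map that is one-to-one on some nonempty open set; a one-sided shift space $\mathsf Y^+$ is called AFT if the two-sided shift space $\mathsf Y$ is AFT. For $w\in\mathcal B(\mathsf X)$ put $P_f(w)=\{v\in\mathcal B(\mathsf X): vw\in\mathcal B(\mathsf X)\}$.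 The *past set cover* $(E_P,\mathcal L_P)$ of $\mathsf X$ is the labelled directed graph whose vertices are the sets $P_f(w)$, $w\in\mathcal B(\mathsf X)$ nonempty, with exactly one edge labelled $a\in\mathcal A$ from $P_f(w)$ to $P_f(v)$ if $av\in\mathcal B(\mathsf X)$ and $P_f(av)=P_f(w)$, and no such edge otherwise. A directed graph is *irreducible* if for every ordered pair of vertices $(u,v)$ there is a finite (possibly empty) directed path from $u$ to $v$, and *reducible* otherwise. **Theorem.** If $\mathsf X$ is a (one- or two-sided) irreducible, strictly sofic AFT shift, then its past set cover $(E_P,\mathcal L_P)$ is reducible. The same holds if the predecessor set of the empty word is also admitted as a vertex. -/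

import Mathlib

open SymbolicDynamics.FullShift

namespace SoficShift

universe u v w

/-! Shift spaces are closed shift-invariant sets of sequences indexed by `M`, where `M = ℤ` gives
two-sided shifts and `M = ℕ` gives one-sided shifts. -/

/-- The word `w` occurs in the sequence `x`, starting at some position `i`. -/
def Occurs {A : Type u} {M : Type*} [AddMonoidWithOne M] (w : List A) (x : M → A) : Prop :=
  ∃ i : M, ∀ (j : ℕ) (hj : j < w.length), x (i + (j : M)) = w[j]

/-- The language of a shift space: the words (the empty word included) that occur in its points. -/
def language {A : Type u} [TopologicalSpace A] {M : Type*} [AddMonoidWithOne M]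
    (X : Subshift A M) : Set (List A) :=
  {w | ∃ x ∈ X.carrier, Occurs w x}

/-- Irreducible shift space: any two words `u`, `w` of the language can be joined, in this order,
by a word `v` such that `u v w` is in the language. -/
def IrreducibleShift {A : Type u} [TopologicalSpace A] {M : Type*} [AddMonoidWithOne M]
    (X : Subshift A M) : Prop :=
  ∀ u ∈ language X, ∀ w ∈ language X, ∃ v ∈ language X, u ++ v ++ w ∈ language X

/-- Shift of finite type: the set of all sequences in which no word of some finite set occurs. -/
def IsFiniteType {A : Type u} [TopologicalSpace A] {M : Type*} [AddMonoidWithOne M]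
    (X : Subshift A M) : Prop :=
  ∃ F : Set (List A), F.Finite ∧ X.carrier = {x : M → A | ∀ w ∈ F, ¬ Occurs w x}

/-- `p` restricts to a factor map from `Z` to `X`: it is continuous on `Z`, maps `Z` onto `X`, and
commutes with the shift maps. -/
def IsFactorMap {B : Type v} {A : Type u} [TopologicalSpace B] [TopologicalSpace A]
    {M : Type*} [AddMonoidWithOne M] (Z : Subshift B M) (X : Subshift A M)
    (p : (M → B) → (M → A)) : Prop :=
  ContinuousOn p Z.carrier ∧ p '' Z.carrier = X.carrier ∧
    ∀ z ∈ Z.carrier, p (shift 1 z) = shift 1 (p z)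

/-- Sofic shift: a factor of a shift of finite type (over some finite alphabet). -/
def IsSofic {A : Type u} [TopologicalSpace A] {M : Type*} [AddMonoidWithOne M]
    (X : Subshift A M) : Prop :=
  ∃ (n : ℕ) (Z : Subshift (Fin n) M) (p : (M → Fin n) → (M → A)),
    IsFiniteType Z ∧ IsFactorMap Z X p

/-- Strictly sofic shift: sofic, but not of finite type. -/
def IsStrictlySofic {A : Type u} [TopologicalSpace A] {M : Type*} [AddMonoidWithOne M]
    (X : Subshift A M) : Prop :=
  IsSofic X ∧ ¬ IsFiniteType X

/-- A two-sided shift is of almost finite type if it is the image of an irreducible shift of finite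
type `Z` under a factor map that is one-to-one on a nonempty (relatively) open subset of `Z`. -/
def IsAlmostFiniteType {A : Type u} [TopologicalSpace A] (X : Subshift A ℤ) : Prop :=
  ∃ (n : ℕ) (Z : Subshift (Fin n) ℤ) (p : (ℤ → Fin n) → (ℤ → A)),
    IsFiniteType Z ∧ IrreducibleShift Z ∧ IsFactorMap Z X p ∧
      ∃ U : Set (ℤ → Fin n), IsOpen U ∧ (U ∩ Z.carrier).Nonempty ∧ Set.InjOn p (U ∩ Z.carrier)

/-- `Y` is the one-sided shift of the right-rays `x₀ x₁ x₂ …` of the two-sided shift `X`. -/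
def IsRightRayShift {A : Type u} [TopologicalSpace A] (Y : Subshift A ℕ) (X : Subshift A ℤ) :
    Prop :=
  Y.carrier = (fun (x : ℤ → A) (n : ℕ) => x (n : ℤ)) '' X.carrier

/-- A labelled directed graph, with source, range and labelling maps on its edges. -/
structure LabelledGraph (A : Type u) where
  /-- the vertices -/
  V : Type v
  /-- the edges -/
  E : Type w
  /-- the source of an edge -/
  s : E → V
  /-- the range of an edge -/
  r : E → V
  /-- the label of an edge -/
  label : E → A

/-- The underlying quiver of a labelled graph. -/
instance LabelledGraph.quiver {A : Type u} (G : LabelledGraph.{u, v, w} A) : Quiver.{w} G.V where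
  Hom a b := {e : G.E // G.s e = a ∧ G.r e = b}

/-- Irreducible graph: for all vertices `a`, `b` there is a finite (possibly empty) directed path
from `a` to `b`. -/
def LabelledGraph.Irreducible {A : Type u} (G : LabelledGraph.{u, v, w} A) : Prop :=
  Quiver.IsStronglyConnected G.V

/-- Reducible graph: not irreducible. -/
def LabelledGraph.Reducible {A : Type u} (G : LabelledGraph.{u, v, w} A) : Prop :=
  ¬ G.Irreducible

/-- The predecessor set of the word `w`: the words of the language that can precede `w`. -/
def predecessorSet {A : Type u} [TopologicalSpace A] {M : Type*} [AddMonoidWithOne M]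
    (X : Subshift A M) (w : List A) : Set (List A) :=
  {v | v ∈ language X ∧ v ++ w ∈ language X}

/-- The past set graph of `X` on a set `W` of words of `X`. The vertices are the predecessor sets
`P(w)` with `w ∈ W`; there is exactly one edge labelled `a` from `P(w)` to `P(v)` if `a v` is in
the language and `P(a v) = P(w)`, and none otherwise. -/
def pastSetGraph {A : Type u} [TopologicalSpace A] {M : Type*} [AddMonoidWithOne M]
    (X : Subshift A M) (W : Set (List A)) : LabelledGraph.{u, u, u} A where
  V := {P : Set (List A) // ∃ w ∈ W, predecessorSet X w = P}
  E := {e : {P : Set (List A) // ∃ w ∈ W, predecessorSet X w = P} × A ×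
            {P : Set (List A) // ∃ w ∈ W, predecessorSet X w = P} //
          ∃ w ∈ W, ∃ v ∈ W, e.1.1 = predecessorSet X w ∧ e.2.2.1 = predecessorSet X v ∧
            e.2.1 :: v ∈ language X ∧ predecessorSet X (e.2.1 :: v) = predecessorSet X w}
  s e := e.1.1
  r e := e.1.2.2
  label e := e.1.2.1

/-- The past set cover of `X`: the vertices are the predecessor sets of the nonempty words in the
language of `X`. -/
def pastSetCover {A : Type u} [TopologicalSpace A] {M : Type*} [AddMonoidWithOne M]
    (X : Subshift A M) : LabelledGraph.{u, u, u} A :=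
  pastSetGraph X {w | w ∈ language X ∧ w ≠ []}

/-- The variant of the past set cover in which the predecessor set of the empty word is a vertex
as well. -/
def pastSetCoverWithEmpty {A : Type u} [TopologicalSpace A] {M : Type*} [AddMonoidWithOne M]
    (X : Subshift A M) : LabelledGraph.{u, u, u} A :=
  pastSetGraph X (language X)

end SoficShift

/-! If the cover were irreducible, a path from `P(w)` to `P(m)`, spelling `u`, would give `P(w) =
P(u m)` for all nonempty `w`, `m` in the language (`PredecessorsRecur`). For an AFT shift this
forces long words to be synchronizing, hence finite type, a contradiction.

Let `p : Z → X` be the AFT factor map. It is closing on both sides (`exists_isClosing`), and some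
word `m` is magic (`exists_isMagic`): windows over `m` survive every extension of `m`. Suppose `v w
a` and `w a x` are words with `w` long. Recurrence gives `P(a) = P(u m)`, and irreducibility gives
`e` with `m e w a x` in the language. So `v w u m` and `m e w u m` are words too. Their lifts can be
matched at the right-hand `m`, hence inside `w` by left closing; lifts of `m e w u m` and `m e w a
x` can be matched at the left-hand `m`, hence inside `w` by right closing. Gluing there gives `v w a
x` (`isMemoryBound_of_isClosing`).

Only the language enters this argument, and a one-sided shift has the language of its two-sided
shift. -/

namespace SoficShift

/-! ### Words, languages and finite type from bounded memory -/

section Words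

variable {A : Type*} {M : Type*} [AddMonoidWithOne M]

/-- The word `w` occurs in `x` at position `i`. -/
def OccursAt (w : List A) (x : M → A) (i : M) : Prop :=
  ∀ (j : ℕ) (hj : j < w.length), x (i + (j : M)) = w[j]

theorem occursAt_append {u v : List A} {x : M → A} {i : M} :
    OccursAt (u ++ v) x i ↔ OccursAt u x i ∧ OccursAt v x (i + (u.length : M)) := by
  constructor
  · refine fun h => ⟨fun j hj => ?_, fun j hj => ?_⟩
    · rw [h j (by simp; omega), List.getElem_append_left hj]
    · have := h (u.length + j) (by simp; omega)
      rw [List.getElem_append_right (by omega)] at this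
      simpa [add_assoc] using this
  · rintro ⟨h1, h2⟩ j hj
    by_cases hju : j < u.length
    · rw [h1 j hju, List.getElem_append_left hju]
    · obtain ⟨k, rfl⟩ := Nat.exists_eq_add_of_le (not_lt.mp hju)
      rw [List.getElem_append_right (by omega)]
      have := h2 k (by simp at hj; omega)
      simpa [add_assoc] using this

theorem occursAt_shift {w : List A} {x : M → A} {g i : M} :
    OccursAt w (shift g x) i ↔ OccursAt w x (g + i) := by
  simp [OccursAt, add_assoc]

theorem occursAt_ofFn {x : M → A} {i : M} {n : ℕ} {f : Fin n → A} :
    OccursAt (List.ofFn f) x i ↔ ∀ j : Fin n, x (i + ((j : ℕ) : M)) = f j := by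
  constructor
  · intro h j
    simpa using h j (by simp)
  · intro h j hj
    simpa using h ⟨j, by simpa using hj⟩

theorem occurs_of_infix {w w' : List A} {x : M → A} (h : w' <:+: w) (hw : Occurs w x) :
    Occurs w' x := by
  obtain ⟨s, t, rfl⟩ := h
  obtain ⟨i, hi⟩ := hw
  exact ⟨_, (occursAt_append.mp (occursAt_append.mp hi).1).2⟩

variable [TopologicalSpace A] {X : Subshift A M}

theorem left_mem_language {u v : List A} (h : u ++ v ∈ language X) : u ∈ language X := by
  obtain ⟨x, hx, i, hi⟩ := h
  exact ⟨x, hx, i, (occursAt_append.mp hi).1⟩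

theorem right_mem_language {u v : List A} (h : u ++ v ∈ language X) : v ∈ language X := by
  obtain ⟨x, hx, i, hi⟩ := h
  exact ⟨x, hx, _, (occursAt_append.mp hi).2⟩

/-- Long words are synchronizing: a word of length at least `n` may be prolonged on the left and on
the right independently. -/
def IsMemoryBound (L : Set (List A)) (n : ℕ) : Prop :=
  ∀ w : List A, n ≤ w.length → ∀ v x, v ++ w ∈ L → w ++ x ∈ L → v ++ w ++ x ∈ L

/-- Induction on length: a word `a s b` of length above `n + 2` has a synchronizing middle `s`, so
it is obtained from the shorter words `a s` and `s b`. -/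
theorem mem_language_of_forall_infix {n : ℕ} (hn : IsMemoryBound (language X) n) (w : List A)
    (h : ∀ w', w' <:+: w → w'.length ≤ n + 2 → w' ∈ language X) : w ∈ language X := by
  induction hl : w.length using Nat.strong_induction_on generalizing w with
  | _ l ih =>
    by_cases hs : l ≤ n + 2
    · exact h w List.infix_rfl (hl ▸ hs)
    match w, hl with
    | [], hl => simp at hl; omega
    | a :: t, hl =>
      rcases List.eq_nil_or_concat t with rfl | ⟨s, b, rfl⟩
      · simp at hl; omega
      simp only [List.length_cons, List.length_append, List.length_nil, List.concat_eq_append] at hl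
      have h1 : [a] ++ s ∈ language X := by
        refine ih (s.length + 1) (by omega) _ (fun w' hw' => h w' (hw'.trans ?_)) (by simp)
        exact ⟨[], [b], by simp⟩
      have h2 : s ++ [b] ∈ language X := by
        refine ih (s.length + 1) (by omega) _ (fun w' hw' => h w' (hw'.trans ?_)) (by simp)
        exact ⟨[a], [], by simp⟩
      simpa using hn s (by omega) [a] [b] h1 h2

/-- A subshift whose long words are synchronizing is of finite type, provided every finite set of
positions lies in an interval to which every word of the language can be moved. -/
theorem isFiniteType_of_isMemoryBound [Finite A] [DiscreteTopology A] {n : ℕ}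
    (hn : IsMemoryBound (language X) n)
    (hM : ∀ S : Finset M, ∃ (i : M) (k : ℕ), (∀ s ∈ S, ∃ j < k, s = i + (j : M)) ∧
      ∀ i' : M, ∀ y ∈ X.carrier, ∃ y' ∈ X.carrier, ∀ j : ℕ, y' (i + (j : M)) = y (i' + (j : M))) :
    IsFiniteType X := by
  refine ⟨{w | w.length ≤ n + 2 ∧ w ∉ language X}, ?_, ?_⟩
  · exact (List.finite_length_le A (n + 2)).subset fun w hw => hw.1
  · ext x
    refine ⟨fun hx w hw hocc => hw.2 ⟨x, hx, hocc⟩, fun hx => ?_⟩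
    have hlang (w : List A) (hw : Occurs w x) : w ∈ language X := by
      refine mem_language_of_forall_infix hn w fun w' hw' hl => ?_
      by_contra hmem
      exact hx w' ⟨hl, hmem⟩ (occurs_of_infix hw' hw)
    -- As `X` is closed, it suffices to match `x` on finitely many positions, which one long word of
    -- `x` covers.
    rw [← X.isClosed.closure_eq, mem_closure_iff]
    intro o ho hxo
    obtain ⟨S, u, hu, hsub⟩ := isOpen_pi_iff.mp ho x hxo
    obtain ⟨i, k, hS, hmove⟩ := hM S
    obtain ⟨y, hy, i', hi'⟩ := hlang (List.ofFn fun j : Fin k => x (i + ((j : ℕ) : M)))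
      ⟨i, occursAt_ofFn.mpr fun _ => rfl⟩
    obtain ⟨y', hy', hyy⟩ := hmove i' y hy
    refine ⟨y', hsub fun s hs => ?_, hy'⟩
    obtain ⟨j, hj, rfl⟩ := hS s hs
    rw [hyy, occursAt_ofFn.mp hi' ⟨j, hj⟩]
    exact (hu _ hs).2

theorem isFiniteType_nat_of_isMemoryBound [Finite A] [DiscreteTopology A] {X : Subshift A ℕ}
    {n : ℕ} (hn : IsMemoryBound (language X) n) : IsFiniteType X := by
  refine isFiniteType_of_isMemoryBound hn fun S => ⟨0, S.sup id + 1, fun s hs => ⟨s, ?_, ?_⟩, ?_⟩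
  · exact Nat.lt_succ_of_le (Finset.le_sup (f := id) hs)
  · simp
  · intro i' y hy
    exact ⟨shift i' y, X.mapsTo i' hy, fun j => by simp⟩

theorem isFiniteType_int_of_isMemoryBound [Finite A] [DiscreteTopology A] {X : Subshift A ℤ}
    {n : ℕ} (hn : IsMemoryBound (language X) n) : IsFiniteType X := by
  refine isFiniteType_of_isMemoryBound hn fun S => ?_
  have hb : ∀ s ∈ S, s.natAbs ≤ S.sup Int.natAbs := fun s hs => Finset.le_sup hs
  refine ⟨-(S.sup Int.natAbs : ℕ), 2 * S.sup Int.natAbs + 1, fun s hs => ?_, fun i' y hy => ?_⟩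
  · have := hb s hs
    exact ⟨(s + (S.sup Int.natAbs : ℕ)).toNat, by omega, by omega⟩
  · refine ⟨shift (i' + (S.sup Int.natAbs : ℕ)) y, X.mapsTo _ hy, fun j => ?_⟩
    rw [shift_apply]
    congr 1
    ring

end Words

/-! ### Paths in the past set cover -/

section Graph

variable {A : Type*} [TopologicalSpace A] {M : Type*} [AddMonoidWithOne M] {X : Subshift A M}

theorem predecessorSet_cons_congr {a : A} {v w : List A}
    (h : predecessorSet X v = predecessorSet X w) :
    predecessorSet X (a :: v) = predecessorSet X (a :: w) := by
  have key (v w : List A) (h : predecessorSet X v = predecessorSet X w) (t : List A)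
      (ht : t ++ a :: v ∈ language X) : t ++ a :: w ∈ language X := by
    have ht' : t ++ [a] ++ v ∈ language X := by simpa using ht
    have : t ++ [a] ∈ predecessorSet X w := h ▸ ⟨left_mem_language ht', ht'⟩
    simpa using this.2
  ext t
  exact and_congr_right fun _ => ⟨key v w h t, key w v h.symm t⟩

/-- Read backwards, each edge prepends its label to the word. The word representing the range may be
replaced by any other with the same predecessors, since `P(a v)` depends only on `a` and `P(v)`. -/
theorem exists_prefix_of_path {W : Set (List A)} {α β : (pastSetGraph X W).V}
    (γ : Quiver.Path α β) (m : List A) (hm : m ∈ language X) (hβ : β.1 = predecessorSet X m) :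
    ∃ u, u ++ m ∈ language X ∧ α.1 = predecessorSet X (u ++ m) := by
  induction γ generalizing m with
  | nil => exact ⟨[], hm, hβ⟩
  | cons γ e ih =>
    obtain ⟨⟨⟨s, a, r⟩, w, hw, v, hv, hs, hr, hav, hPav⟩, rfl, rfl⟩ := e
    have hvm : predecessorSet X v = predecessorSet X m := hr.symm.trans hβ
    have ham : [a] ++ m ∈ language X := by
      have h1 : [a] ++ v ∈ language X := hav
      have : [a] ∈ predecessorSet X m := hvm ▸ ⟨left_mem_language h1, h1⟩
      exact this.2
    obtain ⟨u, hu, hα⟩ := ih (a :: m) ham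
      (hs.trans (hPav.symm.trans (predecessorSet_cons_congr hvm)))
    exact ⟨u ++ [a], by simpa using hu, by simpa using hα⟩

/-- Every nonempty word of the language `L` has the predecessors of some word that ends in a
prescribed nonempty word of `L`. -/
def PredecessorsRecur (L : Set (List A)) : Prop :=
  ∀ w ∈ L, w ≠ [] → ∀ m ∈ L, m ≠ [] →
    ∃ u, u ++ m ∈ L ∧ ∀ v, v ++ w ∈ L ↔ v ++ (u ++ m) ∈ L

theorem predecessorsRecur_of_irreducible {W : Set (List A)}
    (hW : ∀ w ∈ language X, w ≠ [] → w ∈ W) (h : (pastSetGraph X W).Irreducible) :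
    PredecessorsRecur (language X) := by
  intro w hw hw0 m hm hm0
  obtain ⟨γ⟩ := h ⟨_, w, hW w hw hw0, rfl⟩ ⟨_, m, hW m hm hm0, rfl⟩
  obtain ⟨u, hu, hP⟩ := exists_prefix_of_path γ m hm rfl
  refine ⟨u, hu, fun v => ?_⟩
  have hv := Set.ext_iff.mp hP v
  exact ⟨fun h => (hv.mp ⟨left_mem_language h, h⟩).2, fun h => (hv.mpr ⟨left_mem_language h, h⟩).2⟩

end Graph

/-! ### Block codes, gluing and closing factor maps -/

section Closing

variable {A B : Type*}

/-- `z` and `z'` agree on the window of radius `N` around `c`. -/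
def AgreeNear (N : ℕ) (z z' : ℤ → B) (c : ℤ) : Prop :=
  ∀ k : ℤ, c - N ≤ k → k ≤ c + N → z k = z' k

theorem AgreeNear.trans {N : ℕ} {z z' z'' : ℤ → B} {c : ℤ} (h : AgreeNear N z z' c)
    (h' : AgreeNear N z' z'' c) : AgreeNear N z z'' c :=
  fun k h1 h2 => (h k h1 h2).trans (h' k h1 h2)

theorem AgreeNear.symm {N : ℕ} {z z' : ℤ → B} {c : ℤ} (h : AgreeNear N z z' c) :
    AgreeNear N z' z c :=
  fun k h1 h2 => (h k h1 h2).symm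

theorem agreeNear_shift {N : ℕ} {z z' : ℤ → B} {c g : ℤ} :
    AgreeNear N (shift g z) (shift g z') c ↔ AgreeNear N z z' (g + c) := by
  refine ⟨fun h k h1 h2 => ?_, fun h k h1 h2 => h _ (by omega) (by omega)⟩
  simpa using h (k - g) (by omega) (by omega)

theorem exists_forall_not_of_isClosed {K : Type*} [TopologicalSpace K] [CompactSpace K]
    (P : ℕ → K → Prop) (hcl : ∀ n, IsClosed {x | P n x}) (hanti : ∀ n x, P (n + 1) x → P n x)
    (h : ∀ x, ∃ n, ¬ P n x) : ∃ n, ∀ x, ¬ P n x := by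
  by_contra! hne
  obtain ⟨x, hx⟩ := IsCompact.nonempty_iInter_of_sequence_nonempty_isCompact_isClosed
    (fun n => {x | P n x}) (fun n x => hanti n x) hne (hcl 0).isCompact hcl
  obtain ⟨n, hn⟩ := h x
  exact hn (Set.mem_iInter.mp hx n)

variable [TopologicalSpace B]

/-- `p` is injective on the points of `Z` with a certain central window. -/
theorem exists_window_injective {Z : Subshift B ℤ} {p : (ℤ → B) → (ℤ → A)} {U : Set (ℤ → B)}
    (hU : IsOpen U) (hne : (U ∩ Z.carrier).Nonempty) (hinj : Set.InjOn p (U ∩ Z.carrier)) :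
    ∃ z₀ ∈ Z.carrier, ∃ R₀ : ℕ, ∀ R, R₀ ≤ R → ∀ z ∈ Z.carrier, ∀ z' ∈ Z.carrier,
      AgreeNear R z z₀ 0 → AgreeNear R z' z₀ 0 → p z = p z' → z = z' := by
  obtain ⟨z₀, hz₀U, hz₀⟩ := hne
  obtain ⟨S, u, hu, hsub⟩ := isOpen_pi_iff.mp hU z₀ hz₀U
  refine ⟨z₀, hz₀, S.sup Int.natAbs, fun R hR z hz z' hz' h h' hpz => ?_⟩
  have hmem {z : ℤ → B} (h : AgreeNear R z z₀ 0) : z ∈ U := by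
    refine hsub fun s hs => ?_
    have : s.natAbs ≤ S.sup Int.natAbs := Finset.le_sup hs
    rw [h s (by omega) (by omega)]
    exact (hu s hs).2
  exact hinj ⟨hmem h, hz⟩ ⟨hmem h', hz'⟩ hpz

theorem continuous_carrier_coord (Z : Subshift B ℤ) (j : ℤ) :
    Continuous fun z : Z.carrier => z.1 j :=
  (continuous_apply j).comp continuous_subtype_val

theorem Subshift.compactSpace_carrier [Finite B] (Z : Subshift B ℤ) : CompactSpace Z.carrier :=
  isCompact_iff_compactSpace.mp Z.isClosed.isCompact

/-- Right closing (`e = 1`) or left closing (`e = -1`) with delay `D`, relative to windows of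
radius `N`. -/
def IsClosing (Z : Subshift B ℤ) (p : (ℤ → B) → (ℤ → A)) (N : ℕ) (e : ℤ) (D : ℕ) : Prop :=
  ∀ z ∈ Z.carrier, ∀ z' ∈ Z.carrier, ∀ (c : ℤ) (n : ℕ), AgreeNear N z z' c →
    (∀ j : ℕ, j ≤ n → p z (c + e * j) = p z' (c + e * j)) →
      ∀ j : ℕ, j + D ≤ n → AgreeNear N z z' (c + e * j)

theorem IsClosing.mono {Z : Subshift B ℤ} {p : (ℤ → B) → (ℤ → A)} {N : ℕ} {e : ℤ} {D D' : ℕ}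
    (h : IsClosing Z p N e D) (hD : D ≤ D') : IsClosing Z p N e D' :=
  fun z hz z' hz' c n hc hpz j hj => h z hz z' hz' c n hc hpz j (by omega)

variable [TopologicalSpace A]

theorem IsFactorMap.map_shift {Z : Subshift B ℤ} {X : Subshift A ℤ} {p : (ℤ → B) → (ℤ → A)}
    (hp : IsFactorMap Z X p) {z : ℤ → B} (hz : z ∈ Z.carrier) (g : ℤ) :
    p (shift g z) = shift g (p z) := by
  have hnat (n : ℕ) {z : ℤ → B} (hz : z ∈ Z.carrier) : p (shift (n : ℤ) z) = shift (n : ℤ) (p z) := by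
    induction n with
    | zero => simp
    | succ n ih =>
      push_cast
      rw [shift_add, shift_add, hp.2.2 _ (Z.mapsTo _ hz), ih]
  obtain ⟨n, rfl | rfl⟩ := g.eq_nat_or_neg
  · exact hnat n hz
  · have := hnat n (Z.mapsTo (-(n : ℤ)) hz)
    rw [← shift_add, neg_add_cancel, shift_zero] at this
    rw [this, ← shift_add, add_neg_cancel, shift_zero]

/-- A language-irreducible subshift has points that contain two given windows in a given order. -/
theorem IrreducibleShift.exists_agreeNear {Z : Subshift B ℤ} (hZ : IrreducibleShift Z)
    {z z' : ℤ → B} (hz : z ∈ Z.carrier) (hz' : z' ∈ Z.carrier) (N : ℕ) :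
    ∃ y ∈ Z.carrier, ∃ t : ℕ, AgreeNear N y z 0 ∧ AgreeNear N (shift (t : ℤ) y) z' 0 := by
  have hmem {z : ℤ → B} (hz : z ∈ Z.carrier) :
      (List.ofFn fun j : Fin (2 * N + 1) => z (-N + ((j : ℕ) : ℤ))) ∈ language Z :=
    ⟨z, hz, -N, occursAt_ofFn.mpr fun _ => rfl⟩
  have hagree {y z : ℤ → B} {i : ℤ}
      (h : OccursAt (List.ofFn fun j : Fin (2 * N + 1) => z (-N + ((j : ℕ) : ℤ))) y (i - N)) :
      AgreeNear N (shift i y) z 0 := by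
    intro k h1 h2
    have := occursAt_ofFn.mp h ⟨(k + N).toNat, by omega⟩
    simp only [Int.toNat_of_nonneg (show 0 ≤ k + N by omega)] at this
    rw [shift_apply]
    convert this using 2 <;> ring
  obtain ⟨v, -, y, hy, i, hi⟩ := hZ _ (hmem hz) _ (hmem hz')
  change OccursAt _ y i at hi
  rw [occursAt_append, occursAt_append] at hi
  refine ⟨shift (i + N) y, Z.mapsTo _ hy, 2 * N + 1 + v.length, hagree ?_, ?_⟩
  · rw [add_sub_cancel_right]
    exact hi.1.1
  · rw [← shift_add]
    apply hagree
    convert hi.2 using 1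
    simp
    ring

theorem IsFactorMap.continuous_coord {Z : Subshift B ℤ} {X : Subshift A ℤ}
    {p : (ℤ → B) → (ℤ → A)} (hp : IsFactorMap Z X p) (j : ℤ) :
    Continuous fun z : Z.carrier => p z.1 j :=
  (continuous_apply j).comp (continuousOn_iff_continuous_domRestrict.mp hp.1)

variable [DiscreteTopology A] [DiscreteTopology B] [Finite B]

theorem isClosed_agreeNear {Z : Subshift B ℤ} (N : ℕ) (c : ℤ) :
    IsClosed {x : Z.carrier × Z.carrier | AgreeNear N x.1.1 x.2.1 c} := by
  simp only [AgreeNear, Set.ofPred_forall]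
  refine isClosed_iInter fun k => isClosed_iInter fun _ => isClosed_iInter fun _ =>
    isClosed_eq
      ((continuous_carrier_coord Z k).comp continuous_fst)
      ((continuous_carrier_coord Z k).comp continuous_snd)

/-- A factor map is a sliding block code. -/
theorem IsFactorMap.exists_radius {Z : Subshift B ℤ} {X : Subshift A ℤ} {p : (ℤ → B) → (ℤ → A)}
    (hp : IsFactorMap Z X p) :
    ∃ r : ℕ, ∀ z ∈ Z.carrier, ∀ z' ∈ Z.carrier, ∀ j, AgreeNear r z z' j → p z j = p z' j := by
  have := Subshift.compactSpace_carrier Z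
  obtain ⟨r, hr⟩ := exists_forall_not_of_isClosed
    (fun r (x : Z.carrier × Z.carrier) => AgreeNear r x.1.1 x.2.1 0 ∧ p x.1.1 0 ≠ p x.2.1 0)
    (fun r => (isClosed_agreeNear r 0).inter
      ((isClosed_discrete {a : A × A | a.1 ≠ a.2}).preimage
        (((hp.continuous_coord 0).comp continuous_fst).prodMk
          ((hp.continuous_coord 0).comp continuous_snd))))
    (fun r x h => ⟨fun k h1 h2 => h.1 k (by omega) (by omega), h.2⟩)
    (fun x => by
      by_contra! h
      refine (h 0).2 (congrArg (fun z => p z 0) (funext fun k => ?_))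
      exact (h k.natAbs).1 k (by omega) (by omega))
  refine ⟨r, fun z hz z' hz' j hj => ?_⟩
  by_contra hne
  refine hr ⟨⟨_, Z.mapsTo j hz⟩, ⟨_, Z.mapsTo j hz'⟩⟩ ⟨agreeNear_shift.mpr (by simpa using hj), ?_⟩
  simpa [hp.map_shift hz, hp.map_shift hz'] using hne

/-- Points of `Z` that agree near some position can be glued there, and `p` respects this. -/
def IsGluingRadius (Z : Subshift B ℤ) (p : (ℤ → B) → (ℤ → A)) (N : ℕ) : Prop :=
  ∀ z ∈ Z.carrier, ∀ z' ∈ Z.carrier, ∀ c : ℤ, AgreeNear N z z' c →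
    ∃ y ∈ Z.carrier, (∀ j ≤ c + N, y j = z j) ∧ (∀ j, c - N ≤ j → y j = z' j) ∧
      (∀ j ≤ c, p y j = p z j) ∧ ∀ j, c ≤ j → p y j = p z' j

theorem exists_isGluingRadius {Z : Subshift B ℤ} {X : Subshift A ℤ} {p : (ℤ → B) → (ℤ → A)}
    (hZ : IsFiniteType Z) (hp : IsFactorMap Z X p) :
    ∃ N₀, ∀ N, N₀ ≤ N → IsGluingRadius Z p N := by
  obtain ⟨F, hF, hZF⟩ := hZ
  obtain ⟨r, hr⟩ := hp.exists_radius
  obtain ⟨K, hK⟩ := (hF.image List.length).bddAbove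
  -- `K` bounds the forbidden words and `r` is the radius of the block code.
  refine ⟨max K r, fun N hN z hz z' hz' c hc => ?_⟩
  let y : ℤ → B := fun j => if j ≤ c then z j else z' j
  have hleft : ∀ j ≤ c + N, y j = z j := by
    intro j hj
    by_cases h : j ≤ c
    · simp [y, h]
    · simp [y, h, hc j (by omega) hj]
  have hright : ∀ j, c - N ≤ j → y j = z' j := by
    intro j hj
    by_cases h : j ≤ c
    · simp [y, h, hc j hj (by omega)]
    · simp [y, h]
  have hy : y ∈ Z.carrier := by
    rw [hZF] at hz hz' ⊢
    rintro w hw ⟨i, hi⟩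
    have hlen : w.length ≤ K := hK ⟨w, hw, rfl⟩
    -- A word of length at most `K ≤ N` lies wholly in the part copied from `z` or in the part
    -- copied from `z'`.
    by_cases h : i + w.length ≤ c + N + 1
    · exact hz w hw ⟨i, fun j hj => by rw [← hleft _ (by omega), hi j hj]⟩
    · exact hz' w hw ⟨i, fun j hj => by rw [← hright _ (by omega), hi j hj]⟩
  exact ⟨y, hy, hleft, hright,
    fun j hj => hr y hy z hz j fun k h1 h2 => hleft k (by omega),
    fun j hj => hr y hy z' hz' j fun k h1 h2 => hright k (by omega)⟩

/-- By compactness, finitely many image letters already determine the first coordinate beyond the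
window, at `e * (N + 1)`. Shift invariance then moves the window one step at a time. -/
theorem exists_isClosing_of_ray {Z : Subshift B ℤ} {X : Subshift A ℤ} {p : (ℤ → B) → (ℤ → A)}
    (hp : IsFactorMap Z X p) {N : ℕ} {e : ℤ} (he : e = 1 ∨ e = -1)
    (h : ∀ z ∈ Z.carrier, ∀ z' ∈ Z.carrier, AgreeNear N z z' 0 →
      (∀ j : ℕ, p z (e * j) = p z' (e * j)) → ∀ j : ℕ, z (e * j) = z' (e * j)) :
    ∃ D, IsClosing Z p N e D := by
  have := Subshift.compactSpace_carrier Z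
  obtain ⟨D, hD⟩ := exists_forall_not_of_isClosed
    (fun D (x : Z.carrier × Z.carrier) => AgreeNear N x.1.1 x.2.1 0 ∧
      (∀ j : ℕ, j ≤ D → p x.1.1 (e * j) = p x.2.1 (e * j)) ∧
      x.1.1 (e * (N + 1 : ℕ)) ≠ x.2.1 (e * (N + 1 : ℕ)))
    (fun D => by
      refine (isClosed_agreeNear N 0).inter (IsClosed.inter ?_ ?_)
      · change IsClosed {x : Z.carrier × Z.carrier |
          ∀ j : ℕ, j ≤ D → p x.1.1 (e * j) = p x.2.1 (e * j)}
        simp only [Set.ofPred_forall]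
        exact isClosed_iInter fun j => isClosed_iInter fun _ => isClosed_eq
          ((hp.continuous_coord _).comp continuous_fst) ((hp.continuous_coord _).comp continuous_snd)
      · refine (isClosed_discrete {b : B × B | b.1 ≠ b.2}).preimage (Continuous.prodMk
          ((continuous_carrier_coord Z _).comp continuous_fst)
          ((continuous_carrier_coord Z _).comp continuous_snd)))
    (fun D x h => ⟨h.1, fun j hj => h.2.1 j (by omega), h.2.2⟩)
    (fun x => by
      by_contra! hx
      exact (hx 0).2.2 (h _ x.1.2 _ x.2.2 (hx 0).1 (fun j => (hx j).2.1 j le_rfl) _))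
  have step : ∀ z ∈ Z.carrier, ∀ z' ∈ Z.carrier, ∀ c : ℤ, AgreeNear N z z' c →
      (∀ j : ℕ, j ≤ D → p z (c + e * j) = p z' (c + e * j)) → AgreeNear N z z' (c + e) := by
    intro z hz z' hz' c hc hpz
    have hnew : z (c + e * (N + 1 : ℕ)) = z' (c + e * (N + 1 : ℕ)) := by
      by_contra hne
      refine hD ⟨⟨_, Z.mapsTo c hz⟩, ⟨_, Z.mapsTo c hz'⟩⟩
        ⟨agreeNear_shift.mpr (by simpa using hc), fun j hj => ?_, hne⟩
      simpa [hp.map_shift hz, hp.map_shift hz'] using hpz j hj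
    intro k h1 h2
    by_cases hk : k = c + e * (N + 1 : ℕ)
    · rw [hk, hnew]
    · rcases he with rfl | rfl <;> exact hc k (by omega) (by omega)
  refine ⟨D, fun z hz z' hz' c n hc hpz j => ?_⟩
  induction j with
  | zero => simpa using fun _ => hc
  | succ j ih =>
    intro hj
    have := step z hz z' hz' _ (ih (by omega)) fun i hi => by
      have := hpz (j + i) (by omega)
      push_cast at this
      rwa [mul_add, ← add_assoc] at this
    push_cast
    rwa [mul_add, mul_one, ← add_assoc]

/-- A factor map from an irreducible shift of finite type that is injective on a nonempty open set
is closing on both sides. -/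
theorem exists_isClosing {Z : Subshift B ℤ} {X : Subshift A ℤ} {p : (ℤ → B) → (ℤ → A)}
    (hirr : IrreducibleShift Z) (hp : IsFactorMap Z X p) {N : ℕ} (hglue : IsGluingRadius Z p N)
    {z₀ : ℤ → B} (hz₀ : z₀ ∈ Z.carrier)
    (hinj : ∀ z ∈ Z.carrier, ∀ z' ∈ Z.carrier,
      AgreeNear N z z₀ 0 → AgreeNear N z' z₀ 0 → p z = p z' → z = z')
    {e : ℤ} (he : e = 1 ∨ e = -1) : ∃ D, IsClosing Z p N e D := by
  have hinj_shift {g : ℤ} {y y' : ℤ → B} (hy : y ∈ Z.carrier) (hy' : y' ∈ Z.carrier)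
      (h : AgreeNear N (shift g y) z₀ 0) (h' : AgreeNear N (shift g y') z₀ 0) (hpy : p y = p y') :
      y = y' := by
    have := hinj _ (Z.mapsTo g hy) _ (Z.mapsTo g hy') h h'
      (by rw [hp.map_shift hy, hp.map_shift hy', hpy])
    ext k
    simpa using congrFun this (k - g)
  refine exists_isClosing_of_ray hp he fun z hz z' hz' hzz hpz j => ?_
  rcases he with rfl | rfl
  -- Give `z` and `z'` a common past through the window of `z₀`. The glued points have equal images,
  -- so they coincide by injectivity near `z₀`.
  · obtain ⟨x, hx, t, hxz₀, hxz⟩ := hirr.exists_agreeNear hz₀ hz N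
    have hx' := Z.mapsTo (t : ℤ) hx
    obtain ⟨y, hy, hyl, hyr, hpl, hpr⟩ := hglue _ hx' z hz 0 hxz
    obtain ⟨y', hy', hyl', hyr', hpl', hpr'⟩ := hglue _ hx' z' hz' 0 (hxz.trans hzz)
    have hblock {y : ℤ → B} (hyl : ∀ j ≤ (0 : ℤ) + N, y j = shift (t : ℤ) x j) :
        AgreeNear N (shift (-(t : ℤ)) y) z₀ 0 := fun k h1 h2 => by
      rw [shift_apply, hyl _ (by omega), shift_apply, add_neg_cancel_left, hxz₀ k h1 h2]
    have heq := hinj_shift hy hy' (hblock hyl) (hblock hyl') (by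
      ext k
      rcases le_total k 0 with hk | hk
      · rw [hpl k hk, hpl' k hk]
      · have := hpz k.toNat
        rw [one_mul, Int.toNat_of_nonneg hk] at this
        rw [hpr k hk, hpr' k hk, this])
    rw [← hyr _ (by omega), ← hyr' _ (by omega), heq]
  -- The mirror image: a common future through the window of `z₀`.
  · obtain ⟨x, hx, t, hxz, hxz₀⟩ := hirr.exists_agreeNear hz hz₀ N
    obtain ⟨y, hy, hyl, hyr, hpl, hpr⟩ := hglue z hz x hx 0 hxz.symm
    obtain ⟨y', hy', hyl', hyr', hpl', hpr'⟩ := hglue z' hz' x hx 0 (hzz.symm.trans hxz.symm)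
    have hblock {y : ℤ → B} (hyr : ∀ j, (0 : ℤ) - N ≤ j → y j = x j) :
        AgreeNear N (shift (t : ℤ) y) z₀ 0 := fun k h1 h2 => by
      rw [shift_apply, hyr _ (by omega), ← hxz₀ k h1 h2, shift_apply]
    have heq := hinj_shift hy hy' (hblock hyr) (hblock hyr') (by
      ext k
      rcases le_total k 0 with hk | hk
      · have := hpz k.natAbs
        rw [show (-1 : ℤ) * (k.natAbs : ℤ) = k by omega] at this
        rw [hpl k hk, hpl' k hk, this]
      · rw [hpr k hk, hpr' k hk])
    rw [← hyl _ (by omega), ← hyl' _ (by omega), heq]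

end Closing

/-! ### Magic words and synchronization -/

section MagicWord

variable {A B : Type*}

theorem OccursAt.eq_of_occursAt {w : List A} {x y : ℤ → A} {i : ℤ} (hx : OccursAt w x i)
    (hy : OccursAt w y i) {k : ℤ} (h1 : i ≤ k) (h2 : k < i + w.length) : x k = y k := by
  have hj : (k - i).toNat < w.length := by omega
  have := (hx _ hj).trans (hy _ hj).symm
  rwa [Int.toNat_of_nonneg (by omega), add_sub_cancel] at this

theorem OccursAt.congr {w : List A} {x y : ℤ → A} {i : ℤ} (hx : OccursAt w x i)
    (h : ∀ k, i ≤ k → k < i + w.length → x k = y k) : OccursAt w y i :=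
  fun j hj => (h (i + j) (by omega) (by omega)) ▸ hx j hj

variable [TopologicalSpace B] {Z : Subshift B ℤ} {p : (ℤ → B) → (ℤ → A)}

/-- The windows of radius `N` seen at position `c` of the preimages of the word `w`. -/
def preimageWindows (Z : Subshift B ℤ) (p : (ℤ → B) → (ℤ → A)) (N : ℕ) (w : List A) (c : ℕ) :
    Set (Finset.Icc (-(N : ℤ)) N → B) :=
  {f | ∃ z ∈ Z.carrier, OccursAt w (p z) (-(c : ℤ)) ∧ ∀ k : Finset.Icc (-(N : ℤ)) N, z k.1 = f k}

theorem preimageWindows_append_subset (N : ℕ) (u m v : List A) (c : ℕ) :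
    preimageWindows Z p N (u ++ m ++ v) (u.length + c) ⊆ preimageWindows Z p N m c := by
  rintro f ⟨z, hz, hocc, hf⟩
  refine ⟨z, hz, ?_, hf⟩
  have := (occursAt_append.mp (occursAt_append.mp hocc).1).2
  convert this using 1
  push_cast
  ring

variable [TopologicalSpace A] {X : Subshift A ℤ}

theorem IsFactorMap.mem_language_iff (hp : IsFactorMap Z X p) (w : List A) (i : ℤ) :
    w ∈ language X ↔ ∃ z ∈ Z.carrier, OccursAt w (p z) i := by
  constructor
  · rintro ⟨x, hx, i', hi'⟩
    rw [← hp.2.1] at hx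
    obtain ⟨z, hz, rfl⟩ := hx
    refine ⟨shift (i' - i) z, Z.mapsTo _ hz, ?_⟩
    rw [hp.map_shift hz, occursAt_shift, sub_add_cancel]
    exact hi'
  · rintro ⟨z, hz, h⟩
    exact ⟨p z, hp.2.1 ▸ ⟨z, hz, rfl⟩, i, h⟩

/-- The word `m` is magic at position `i`: each window seen at position `i` of some preimage of `m`
is seen there in some preimage of any word of the language that extends `m`. -/
def IsMagic (Z : Subshift B ℤ) (X : Subshift A ℤ) (p : (ℤ → B) → (ℤ → A)) (N : ℕ) (m : List A)
    (i : ℕ) : Prop :=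
  ∀ z ∈ Z.carrier, ∀ t : ℤ, OccursAt m (p z) t → ∀ u v, u ++ m ++ v ∈ language X →
    ∃ z' ∈ Z.carrier, OccursAt (u ++ m ++ v) (p z') (t - u.length) ∧ AgreeNear N z' z (t + i)

/-- Extending a word can only shrink its set of preimage windows, so a word and position with the
fewest windows lose none under extension. -/
theorem exists_isMagic [Finite B] (hp : IsFactorMap Z X p) (N : ℕ) {w : List A}
    (hw : w ∈ language X) (hw0 : w ≠ []) :
    ∃ m ∈ language X, ∃ i < m.length, IsMagic Z X p N m i := by
  obtain ⟨⟨m, i⟩, ⟨hm, hi⟩, hmin⟩ := WellFounded.has_min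
    (measure fun a : List A × ℕ => (preimageWindows Z p N a.1 a.2).ncard).wf
    {a | a.1 ∈ language X ∧ a.2 < a.1.length} ⟨(w, 0), hw, List.length_pos_iff.mpr hw0⟩
  refine ⟨m, hm, i, hi, fun z hz t ht u v huv => ?_⟩
  have hle : ¬ (preimageWindows Z p N (u ++ m ++ v) (u.length + i)).ncard <
      (preimageWindows Z p N m i).ncard :=
    hmin (u ++ m ++ v, u.length + i) ⟨huv, by simp at hi ⊢; omega⟩
  have heq := Set.eq_of_subset_of_ncard_le (preimageWindows_append_subset N u m v i)
    (not_lt.mp hle) (Set.toFinite _)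
  have hmem : (fun k : Finset.Icc (-(N : ℤ)) N => shift (t + i) z k.1) ∈
      preimageWindows Z p N m i := by
    refine ⟨_, Z.mapsTo (t + i) hz, ?_, fun k => rfl⟩
    rwa [hp.map_shift hz, occursAt_shift, add_neg_cancel_right]
  rw [← heq] at hmem
  obtain ⟨y, hy, hocc, hyk⟩ := hmem
  refine ⟨shift (-(t + i)) y, Z.mapsTo _ hy, ?_, fun k h1 h2 => ?_⟩
  · rw [hp.map_shift hy, occursAt_shift]
    convert hocc using 1
    push_cast
    ring
  · have := hyk ⟨-(t + i) + k, Finset.mem_Icc.mpr ⟨by omega, by omega⟩⟩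
    rw [shift_apply, this]
    simp only [shift_apply]
    congr 1
    ring

/-- Once its last letter is split off, a word of length `2 * D + 2` still has `2 * D + 1` letters,
so position `D` is at distance at least `D` from both ends and both closing properties reach it. -/
theorem isMemoryBound_of_isClosing [Finite B] (hX : IrreducibleShift X) (hp : IsFactorMap Z X p)
    {N D : ℕ} (hglue : IsGluingRadius Z p N) (hright : IsClosing Z p N 1 D)
    (hleft : IsClosing Z p N (-1) D) (hrec : PredecessorsRecur (language X)) :
    IsMemoryBound (language X) (2 * D + 2) := by
  intro w hw v x hvw hwx
  rcases List.eq_nil_or_concat w with rfl | ⟨w, a, rfl⟩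
  · simp at hw
  simp only [List.concat_eq_append, List.length_append, List.length_singleton] at *
  have ha : [a] ∈ language X := right_mem_language (right_mem_language hvw)
  obtain ⟨m, hm, i, hi, hmagic⟩ := exists_isMagic hp N ha (by simp)
  obtain ⟨u, -, hu⟩ := hrec [a] ha (by simp) m hm (List.length_pos_iff.mp (by omega))
  obtain ⟨e, -, he⟩ := hX m hm _ hwx
  -- `zC`, `zB` and `zA` lift `v w u m`, `m e w u m` and `m e w a x`, with `w` at position `0`.
  have hC : v ++ w ++ (u ++ m) ∈ language X := (hu _).mp (by simpa using hvw)
  have hB : m ++ e ++ w ++ u ++ m ++ [] ∈ language X := by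
    have : m ++ e ++ w ++ [a] ∈ language X := left_mem_language (v := x) (by simpa using he)
    simpa using (hu _).mp this
  have hA : [] ++ m ++ (e ++ w ++ [a] ++ x) ∈ language X := by simpa using he
  obtain ⟨zC, hzC, hoC⟩ := (hp.mem_language_iff _ (-(v.length : ℤ))).mp hC
  have hoCm : OccursAt m (p zC) (w.length + u.length) := by
    convert (occursAt_append.mp (occursAt_append.mp hoC).2).2 using 1
    simp
  obtain ⟨zB, hzB, hoB, hBC⟩ := hmagic zC hzC _ hoCm _ _ hB
  simp only [List.append_nil, occursAt_append, List.length_append, Nat.cast_add] at hoB hoC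
  obtain ⟨⟨⟨⟨hoBm, hoBe⟩, hoBw⟩, hoBu⟩, hoBm'⟩ := hoB
  obtain ⟨⟨hoCv, hoCw⟩, hoCu, hoCm'⟩ := hoC
  obtain ⟨zA, hzA, hoA, hAB⟩ := hmagic zB hzB _ hoBm _ _ hA
  simp only [List.nil_append, occursAt_append, List.length_append, Nat.cast_add, List.length_nil,
    Nat.cast_zero] at hoA
  obtain ⟨hoAm, ⟨⟨hoAe, hoAw⟩, hoAa⟩, hoAx⟩ := hoA
  have hCBD : AgreeNear N zB zC D := by
    have := hleft zB hzB zC hzC _ (w.length + u.length + i) hBC (fun j hj => ?_)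
      (w.length + u.length + i - D) (by omega)
    · convert this using 1
      push_cast [show D ≤ w.length + u.length + i by omega]
      ring
    · by_cases h1 : j ≤ i
      · exact hoBm'.eq_of_occursAt (by convert hoCm' using 1; ring) (by omega) (by omega)
      by_cases h2 : j ≤ i + u.length
      · exact hoBu.eq_of_occursAt (by convert hoCu using 1; ring) (by omega) (by omega)
      · exact hoBw.eq_of_occursAt (by convert hoCw using 1; ring) (by omega) (by omega)
  have hABD : AgreeNear N zA zB D := by
    have := hright zA hzA zB hzB _ (m.length + e.length + w.length - i - 1) hAB (fun j hj => ?_)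
      (m.length + e.length + D - i) (by omega)
    · convert this using 1
      push_cast [show i ≤ m.length + e.length + D by omega]
      ring
    · by_cases h1 : i + j < m.length
      · exact hoAm.eq_of_occursAt (by convert hoBm using 1; ring) (by omega) (by omega)
      by_cases h2 : i + j < m.length + e.length
      · exact hoAe.eq_of_occursAt (by convert hoBe using 1; ring) (by omega) (by omega)
      · exact hoAw.eq_of_occursAt (by convert hoBw using 1; ring) (by omega) (by omega)
  -- Past of `zC`, which reads `v`; future of `zA`, which reads `a x`; both read `w`.
  obtain ⟨y, hy, -, -, hyl, hyr⟩ := hglue zC hzC zA hzA D (hCBD.symm.trans hABD.symm)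
  refine (hp.mem_language_iff _ (-(v.length : ℤ))).mpr ⟨y, hy, ?_⟩
  simp only [occursAt_append, List.length_append, Nat.cast_add]
  refine ⟨⟨hoCv.congr fun k h1 h2 => (hyl k (by omega)).symm, hoCw.congr fun k h1 h2 => ?_,
    OccursAt.congr (x := p zA) (by convert hoAa using 1; ring)
      fun k h1 h2 => (hyr k (by omega)).symm⟩,
    OccursAt.congr (x := p zA) (by convert hoAx using 1; simp; ring)
      fun k h1 h2 => (hyr k (by simp at h1; omega)).symm⟩
  rcases le_total k D with hk | hk
  · exact (hyl k hk).symm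
  · rw [hyr k hk]
    exact hoCw.eq_of_occursAt (by convert hoAw using 1; ring) h1 h2

end MagicWord

/-! ### Conclusion for one- and two-sided shifts -/

section AlmostFiniteType

variable {A : Type*} [TopologicalSpace A]

theorem language_eq_of_isRightRayShift {Y : Subshift A ℕ} {X : Subshift A ℤ}
    (h : IsRightRayShift Y X) : language Y = language X := by
  ext w
  constructor
  · rintro ⟨y, hy, i, hi⟩
    rw [h] at hy
    obtain ⟨x, hx, rfl⟩ := hy
    exact ⟨x, hx, i, fun j hj => by simpa using hi j hj⟩
  · rintro ⟨x, hx, i, hi⟩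
    refine ⟨fun n => shift i x (n : ℤ), h ▸ ⟨_, X.mapsTo i hx, rfl⟩, 0, fun j hj => ?_⟩
    simpa using hi j hj

theorem reducible_of_not_predecessorsRecur {M : Type*} [AddMonoidWithOne M] {X : Subshift A M}
    (h : ¬ PredecessorsRecur (language X)) :
    (pastSetCover X).Reducible ∧ (pastSetCoverWithEmpty X).Reducible :=
  ⟨fun hirr => h (predecessorsRecur_of_irreducible
    (W := {w | w ∈ language X ∧ w ≠ []}) (fun _ hw hw0 => ⟨hw, hw0⟩) hirr),
    fun hirr => h (predecessorsRecur_of_irreducible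
      (W := language X) (fun _ hw _ => hw) hirr)⟩

variable [DiscreteTopology A]

theorem exists_isMemoryBound {X : Subshift A ℤ} (hX : IrreducibleShift X)
    (hAFT : IsAlmostFiniteType X) (hrec : PredecessorsRecur (language X)) :
    ∃ n, IsMemoryBound (language X) n := by
  obtain ⟨b, Z, p, hfin, hirr, hp, U, hU, hne, hinj⟩ := hAFT
  obtain ⟨N₀, hN₀⟩ := exists_isGluingRadius hfin hp
  obtain ⟨z₀, hz₀, R, hR⟩ := exists_window_injective hU hne hinj
  -- One radius must serve both gluing and injectivity.
  have hglue := hN₀ (max N₀ R) (le_max_left _ _)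
  have hinj' := hR (max N₀ R) (le_max_right _ _)
  obtain ⟨D₁, h₁⟩ := exists_isClosing hirr hp hglue hz₀ hinj' (Or.inl rfl)
  obtain ⟨D₂, h₂⟩ := exists_isClosing hirr hp hglue hz₀ hinj' (Or.inr rfl)
  exact ⟨_, isMemoryBound_of_isClosing hX hp hglue (h₁.mono (le_max_left D₁ D₂))
    (h₂.mono (le_max_right D₁ D₂)) hrec⟩

theorem not_predecessorsRecur_int [Finite A] {X : Subshift A ℤ} (hX : IrreducibleShift X)
    (hsofic : IsStrictlySofic X) (hAFT : IsAlmostFiniteType X) :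
    ¬ PredecessorsRecur (language X) := fun hrec => by
  obtain ⟨n, hn⟩ := exists_isMemoryBound hX hAFT hrec
  exact hsofic.2 (isFiniteType_int_of_isMemoryBound hn)

theorem not_predecessorsRecur_nat [Finite A] {Y : Subshift A ℕ} {X : Subshift A ℤ}
    (hYX : IsRightRayShift Y X) (hY : IrreducibleShift Y) (hsofic : IsStrictlySofic Y)
    (hAFT : IsAlmostFiniteType X) : ¬ PredecessorsRecur (language Y) := fun hrec => by
  have hL := language_eq_of_isRightRayShift hYX
  have hX : IrreducibleShift X := by rwa [IrreducibleShift, ← hL]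
  obtain ⟨n, hn⟩ := exists_isMemoryBound hX hAFT (hL ▸ hrec)
  exact hsofic.2 (isFiniteType_nat_of_isMemoryBound (hL ▸ hn))

end AlmostFiniteType

end SoficShift

theorem theorem4 {A : Type*} [Finite A] [TopologicalSpace A] [DiscreteTopology A] :
    -- two-sided shifts
    (∀ X : SymbolicDynamics.FullShift.Subshift A ℤ,
      SoficShift.IrreducibleShift X → SoficShift.IsStrictlySofic X →
      SoficShift.IsAlmostFiniteType X →
        (SoficShift.pastSetCover X).Reducible ∧
        (SoficShift.pastSetCoverWithEmpty X).Reducible) ∧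
    -- one-sided shifts: the right-ray shift of a two-sided shift `X`, where almost finite type
    -- is a property of `X`
    (∀ (Y : SymbolicDynamics.FullShift.Subshift A ℕ) (X : SymbolicDynamics.FullShift.Subshift A ℤ),
      SoficShift.IsRightRayShift Y X →
      SoficShift.IrreducibleShift Y → SoficShift.IsStrictlySofic Y →
      SoficShift.IsAlmostFiniteType X →
        (SoficShift.pastSetCover Y).Reducible ∧
        (SoficShift.pastSetCoverWithEmpty Y).Reducible) := by
  exact ⟨fun _ hX hsofic hAFT => SoficShift.reducible_of_not_predecessorsRecur
      (SoficShift.not_predecessorsRecur_int hX hsofic hAFT),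
    fun _ _ hYX hY hsofic hAFT => SoficShift.reducible_of_not_predecessorsRecur
      (SoficShift.not_predecessorsRecur_nat hYX hY hsofic hAFT)⟩
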